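/- Let $(X,d)$ be a Polish metric space, i.e. a complete separable metric space, and let $\mathcal K(X)$ be the set of nonempty compact subsets of $X$ with the Hausdorff metric. For a metric space $Y$ let $\ell_\infty(Y)$ be the set of all bounded sequences in $Y$ with the supremum metric $d_1((x_k),(y_k))=\sup_k d(x_k,y_k)$. For $K\in\mathcal K(X)$, a *GIFS$_\infty$ on $\ell_\infty(K)$* is a finite family $\mathcal F=\{f_1,\dots,f_n\}$ of maps $f_i:\ell_\infty(K)\to X$ such that each $f_i$ is a contraction, i.e. has Lipschitz constant $\operatorname{Lip}(f_i)<1$, and satisfies (C1) for every sequence $(K_k)$ of nonempty compact subsets of $K$ (bounded in the Hausdorff metric, which is automatic here), the closure $\overline{f_i\left(\prod_{k=1}^\infty K_k\right)}$ is a nonempty compact subset of $X$. The family $\mathcal F$ *witnesses* that $K$ is a *generalized fractal* if $$K=\bigcup_{i=1}^n\overline{f_i(K\times K\times\cdots)},$$ and $K$ is a generalized fractal if some GIFS$_\infty$ on $\ell_\infty(K)$ witnesses this. Then the set of those $K\in\mathcal K(X)$ such that $K$ is a generalized fractal and, for every $r\in(0,1)$, there is a GIFS$_\infty$ $\mathcal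 F$ on $\ell_\infty(K)$ witnessing this with $\operatorname{Lip}(f)\le r$ for all $f\in\mathcal F$, is co-meager in $\mathcal K(X)$ (its complement is a countable union of nowhere dense sets). -/

import Mathlib

open TopologicalSpace
open scoped NNReal

namespace GIFSInfinity

/-- `ℓ_∞(Y)`: the bounded sequences of points of the metric space `Y` with the supremum metric.
As `ℕ` is discrete, these are the bounded continuous functions `ℕ → Y`. -/
abbrev EllInfty (Y : Type*) [MetricSpace Y] : Type _ :=
  BoundedContinuousFunction ℕ Y

/-- The product `∏ K_k`, as a subset of `ℓ_∞(Y)`, of a sequence `(K_k)` of nonempty compact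
subsets of `Y` which is bounded in the Hausdorff metric. Since `⋃ K_k` is then bounded, every
sequence with `x_k ∈ K_k` for all `k` belongs to `ℓ_∞(Y)`. -/
def seqProd {Y : Type*} [MetricSpace Y] (K : EllInfty (NonemptyCompacts Y)) :
    Set (EllInfty Y) :=
  {x | ∀ k, x k ∈ K k}

/-- `f` is a contraction: its Lipschitz constant is less than `1`. -/
def IsContraction {Y X : Type*} [MetricSpace Y] [MetricSpace X] (f : Y → X) : Prop :=
  ∃ c : ℝ≥0, c < 1 ∧ LipschitzWith c f

/-- Condition (C1): for every bounded sequence `(K_k)` of nonempty compact sets, the closure of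
the image of `∏ K_k` is a nonempty compact set. -/
def SatisfiesC1 {Y X : Type*} [MetricSpace Y] [MetricSpace X] (f : EllInfty Y → X) : Prop :=
  ∀ K : EllInfty (NonemptyCompacts Y),
    ∃ L : NonemptyCompacts X, (L : Set X) = closure (f '' seqProd K)

/-- A generalized iterated function system of infinite order: a finite family of contractions
defined on `ℓ_∞(Y)`, each of which satisfies (C1). -/
structure IsGIFSInfty {Y X : Type*} [MetricSpace Y] [MetricSpace X] {n : ℕ}
    (f : Fin n → EllInfty Y → X) : Prop where
  contraction : ∀ i, IsContraction (f i)
  c1 : ∀ i, SatisfiesC1 (f i)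

/-- The family `f` of maps `ℓ_∞(A) → X` witnesses that `A` is a generalized fractal: it is a
GIFS of infinite order and `A` is the union of the closures of the sets `f_i (A × A × ⋯)`. As `A`
is bounded, `A × A × ⋯` is the whole of `ℓ_∞(A)`. -/
def Witnesses {X : Type*} [MetricSpace X] (A : NonemptyCompacts X) {n : ℕ}
    (f : Fin n → EllInfty A → X) : Prop :=
  IsGIFSInfty f ∧ (A : Set X) = ⋃ i, closure (Set.range (f i))

/-- `A` is a generalized fractal. -/
def IsGeneralizedFractal {X : Type*} [MetricSpace X] (A : NonemptyCompacts X) : Prop :=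
  ∃ (n : ℕ) (f : Fin n → EllInfty A → X), Witnesses A f

end GIFSInfinity

/-!
A nonempty compact set `K` which is either a single point or the union of two nonempty pieces
lying in disjoint open sets is a generalized fractal with arbitrarily small Lipschitz constants,
and such sets form a residual subset of the hyperspace.

*Disconnected sets are fractals* (`exists_witnesses_of_mem_separated`). Let `χ : K → Bool` tell the
two pieces of `K` apart. By compactness there is `s > 0` such that points at distance less than `s`
have the same value of `χ`. Hence two sequences in `K` at supremum distance less than `s` have the
same code `(χ (x k))_k`, while the codes of all sequences fill the Cantor space `ℕ → Bool`. Cover `K`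
by finitely many compact sets of diameter at most `r * s`; by the Hausdorff–Alexandroff theorem each
of them is a continuous image of the Cantor space. The corresponding maps `x ↦ g (χ ∘ x)` have
Lipschitz constant at most `r`, because the image moves only when `x` moves by at least `s`, and then
by at most `r * s`. Condition (C1) holds since the codes of `∏ K_k` form a product of subsets of
`Bool`, which is compact (`witnesses_of_coding`).

*Genericity* (`eventually_residual_mem_separated_or_singleton`). The set `U` of disconnected compact
sets of this kind is open in the Vietoris topology, so `U ∪ (closure U)ᶜ` is open and dense. Finite
sets are dense and a finite set with at least two points belongs to `U`; therefore every compact set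
with at least two points is in `closure U`, and `(closure U)ᶜ` consists of singletons.
-/

open TopologicalSpace
open scoped NNReal

namespace GIFSInfinity

/-! ### Maps that factor through a finite coding -/

section Coding

variable {X : Type*} [MetricSpace X] {A : NonemptyCompacts X} {D : Type*}

theorem exists_ellInfty_apply_eq (a : ℕ → A) : ∃ x : EllInfty A, ∀ k, x k = a k :=
  ⟨BoundedContinuousFunction.mkOfDiscrete a (Metric.diam (A : Set X)) fun j k =>
    Metric.dist_le_diam_of_mem A.isCompact.isBounded (a j).2 (a k).2, fun _ => rfl⟩

/-- The codes of the sequences in `∏ K_k` form the product of the sets of codes of the `K_k`. -/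
theorem image_code_seqProd (χ : A → D) (K : EllInfty (NonemptyCompacts A)) :
    (fun (x : EllInfty A) k => χ (x k)) '' seqProd K = Set.univ.pi fun k => χ '' (K k : Set A) := by
  ext u
  constructor
  · rintro ⟨x, hx, rfl⟩ k -
    exact ⟨x k, hx k, rfl⟩
  · intro hu
    choose a ha hau using fun k => hu k trivial
    obtain ⟨x, hx⟩ := exists_ellInfty_apply_eq a
    exact ⟨x, fun k => by rw [hx]; exact ha k, funext fun k => by simp [hx, hau]⟩

theorem surjective_code {χ : A → D} (hχ : Function.Surjective χ) :
    Function.Surjective fun (x : EllInfty A) k => χ (x k) := by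
  intro u
  choose a ha using fun k => hχ (u k)
  obtain ⟨x, hx⟩ := exists_ellInfty_apply_eq a
  exact ⟨x, funext fun k => by simp [hx, ha]⟩

/-- If `χ` is locally constant at scale `s` and `g` has oscillation at most `r * s`, then
`x ↦ g (χ ∘ x)` is `r`-Lipschitz: sequences at distance less than `s` have equal codes. -/
theorem lipschitzWith_comp_code {χ : A → D} {r : ℝ≥0} {s : ℝ}
    (hχ : ∀ x y, dist x y < s → χ x = χ y) {g : (ℕ → D) → X}
    (hg : ∀ u v, dist (g u) (g v) ≤ r * s) :
    LipschitzWith r fun x : EllInfty A => g fun k => χ (x k) := by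
  refine LipschitzWith.of_dist_le_mul fun x y => ?_
  rcases lt_or_ge (dist x y) s with h | h
  · have : (fun k => χ (x k)) = fun k => χ (y k) :=
      funext fun k => hχ _ _ ((BoundedContinuousFunction.dist_coe_le_dist k).trans_lt h)
    simp only [this, dist_self]
    positivity
  · exact (hg _ _).trans (by gcongr)

variable [TopologicalSpace D]

theorem satisfiesC1_comp_code [Finite D] (χ : A → D) {g : (ℕ → D) → X} (hg : Continuous g) :
    SatisfiesC1 fun x : EllInfty A => g fun k => χ (x k) := by
  intro K
  have himage : (fun x : EllInfty A => g fun k => χ (x k)) '' seqProd K =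
      g '' Set.univ.pi fun k => χ '' (K k : Set A) := by
    rw [← image_code_seqProd, Set.image_image]
  have hcompact : IsCompact (g '' Set.univ.pi fun k => χ '' (K k : Set A)) :=
    (isCompact_univ_pi fun k => (Set.toFinite _).isCompact).image hg
  refine ⟨⟨⟨_, hcompact⟩, ?_⟩, ?_⟩
  · exact (Set.univ_pi_nonempty_iff.2 fun k => (K k).nonempty.image χ).image g
  · rw [himage, hcompact.isClosed.closure_eq]
    rfl

theorem witnesses_of_coding [Finite D] {χ : A → D} (hsurj : Function.Surjective χ) {r : ℝ≥0}
    (hr : r < 1) {s : ℝ} (hχ : ∀ x y, dist x y < s → χ x = χ y) {n : ℕ}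
    {g : Fin n → (ℕ → D) → X} (hg : ∀ i, Continuous (g i))
    (hdist : ∀ i u v, dist (g i u) (g i v) ≤ r * s) (hA : (A : Set X) = ⋃ i, Set.range (g i)) :
    ∃ f : Fin n → EllInfty A → X, Witnesses A f ∧ ∀ i, LipschitzWith r (f i) := by
  have hlip := fun i => lipschitzWith_comp_code hχ (hdist i)
  refine ⟨fun i x => g i fun k => χ (x k),
    ⟨⟨fun i => ⟨r, hr, hlip i⟩, fun i => satisfiesC1_comp_code χ (hg i)⟩, ?_⟩, hlip⟩
  rw [hA]
  refine Set.iUnion_congr fun i => ?_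
  have hrange : Set.range (fun x : EllInfty A => g i fun k => χ (x k)) = Set.range (g i) :=
    (surjective_code hsurj).range_comp (g i)
  rw [hrange, (isCompact_range (hg i)).isClosed.closure_eq]

end Coding

/-! ### Small pieces as continuous images of the Cantor space -/

theorem exists_iUnion_range_cantor {X : Type*} [MetricSpace X] (A : NonemptyCompacts X) {ε : ℝ}
    (hε : 0 < ε) :
    ∃ (n : ℕ) (g : Fin n → (ℕ → Bool) → X), (∀ i, Continuous (g i)) ∧
      (∀ i u v, dist (g i u) (g i v) ≤ ε) ∧ (A : Set X) = ⋃ i, Set.range (g i) := by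
  obtain ⟨t, htA, htfin, hcover⟩ := A.isCompact.finite_cover_balls (half_pos hε)
  obtain ⟨n, ⟨e⟩⟩ := htfin.exists_equiv_fin
  have hpiece : ∀ c : t, ∃ g : (ℕ → Bool) → X, Continuous g ∧
      Set.range g = (A : Set X) ∩ Metric.closedBall c (ε / 2) := by
    intro c
    have : CompactSpace ((A : Set X) ∩ Metric.closedBall c (ε / 2) : Set X) :=
      isCompact_iff_compactSpace.1 (A.isCompact.inter_right Metric.isClosed_closedBall)
    have : Nonempty ((A : Set X) ∩ Metric.closedBall c (ε / 2) : Set X) :=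
      ⟨⟨c, htA c.2, Metric.mem_closedBall_self (half_pos hε).le⟩⟩
    obtain ⟨g, hg, hgsurj⟩ := exists_nat_bool_continuous_surjective_of_compact
      ((A : Set X) ∩ Metric.closedBall c (ε / 2) : Set X)
    exact ⟨fun u => g u, continuous_subtype_val.comp hg, 
      (hgsurj.range_comp (Subtype.val : _ → X)).trans Subtype.range_val⟩
  choose g hg hrange using hpiece
  refine ⟨n, fun i => g (e.symm i), fun i => hg _, fun i u v => ?_, ?_⟩
  · have hmem : ∀ w, dist (g (e.symm i) w) (e.symm i) ≤ ε / 2 := fun w =>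
      ((hrange (e.symm i)).subset (Set.mem_range_self w)).2
    linarith [dist_triangle_right (g (e.symm i) u) (g (e.symm i) v) (e.symm i : X), hmem u, hmem v]
  · refine Set.Subset.antisymm (fun x hx => ?_) (Set.iUnion_subset fun i => ?_)
    · obtain ⟨c, hc, hxc⟩ := Set.mem_iUnion₂.1 (hcover hx)
      refine Set.mem_iUnion.2 ⟨e ⟨c, hc⟩, ?_⟩
      simp only [e.symm_apply_apply, hrange]
      exact ⟨hx, Metric.ball_subset_closedBall hxc⟩
    · rw [hrange]
      exact Set.inter_subset_left

/-! ### Disconnected compact sets and singletons -/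

/-- The nonempty compact sets that are covered by two disjoint open sets, both of which they meet.
For compact sets in a metric space this is the same as being disconnected. -/
def separated (X : Type*) [TopologicalSpace X] : Set (NonemptyCompacts X) :=
  {K | ∃ u v : Set X, IsOpen u ∧ IsOpen v ∧ Disjoint u v ∧ (K : Set X) ⊆ u ∪ v ∧
    ((K : Set X) ∩ u).Nonempty ∧ ((K : Set X) ∩ v).Nonempty}

variable {X : Type*} [MetricSpace X]

theorem exists_coding_of_mem_separated {K : NonemptyCompacts X} (hK : K ∈ separated X) :
    ∃ (χ : K → Bool) (s : ℝ), Function.Surjective χ ∧ 0 < s ∧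
      ∀ x y, dist x y < s → χ x = χ y := by
  classical
  obtain ⟨u, v, hu, hv, huv, hKuv, ⟨a, haK, ha⟩, ⟨b, hbK, hb⟩⟩ := hK
  obtain ⟨s, hs, hball⟩ := lebesgue_number_lemma_of_metric (c := fun i : Bool => bif i then u else v)
    K.isCompact (by rintro (_ | _) <;> assumption)
    (fun x hx => by simpa [Set.mem_iUnion, or_comm] using hKuv hx)
  refine ⟨fun x => decide ((x : X) ∈ u), s, ?_, hs, fun x y hxy => ?_⟩
  · rintro (_ | _)
    · exact ⟨⟨b, hbK⟩, by simpa using huv.notMem_of_mem_right hb⟩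
    · exact ⟨⟨a, haK⟩, by simpa using ha⟩
  · obtain ⟨i, hi⟩ := hball x x.2
    have hx := hi (Metric.mem_ball_self hs)
    have hy := hi (show (y : X) ∈ Metric.ball (x : X) s by rw [Metric.mem_ball, dist_comm]; exact hxy)
    cases i
    · simp [huv.notMem_of_mem_right hx, huv.notMem_of_mem_right hy]
    · simpa using iff_of_true hx hy

theorem exists_witnesses_of_mem_separated {K : NonemptyCompacts X} (hK : K ∈ separated X)
    {r : ℝ≥0} (hr₀ : 0 < r) (hr₁ : r < 1) :
    ∃ (n : ℕ) (f : Fin n → EllInfty K → X), Witnesses K f ∧ ∀ i, LipschitzWith r (f i) := by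
  obtain ⟨χ, s, hsurj, hs, hχ⟩ := exists_coding_of_mem_separated hK
  obtain ⟨n, g, hg, hdist, hrange⟩ :=
    exists_iUnion_range_cantor K (mul_pos (NNReal.coe_pos.2 hr₀) hs)
  exact ⟨n, witnesses_of_coding hsurj hr₁ hχ hg hdist hrange⟩

theorem exists_witnesses_singleton (a : X) {r : ℝ≥0} (hr : r < 1) :
    ∃ (n : ℕ) (f : Fin n → EllInfty ({a} : NonemptyCompacts X) → X),
      Witnesses {a} f ∧ ∀ i, LipschitzWith r (f i) :=
  ⟨1, witnesses_of_coding (D := Unit) (χ := fun _ => ()) (s := 0)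
    (g := fun _ _ => a) (fun _ => ⟨⟨a, rfl⟩, rfl⟩) hr (fun _ _ _ => rfl)
    (fun _ => continuous_const) (fun _ _ _ => by simp) (by simp)⟩

/-! ### Genericity -/

theorem isOpen_separated : IsOpen (separated X) := by
  refine isOpen_iff_forall_mem_open.2 fun K => ?_
  rintro ⟨u, v, hu, hv, huv, hK⟩
  refine ⟨{L | (L : Set X) ⊆ u ∪ v ∧ ((L : Set X) ∩ u).Nonempty ∧ ((L : Set X) ∩ v).Nonempty},
    fun L hL => ⟨u, v, hu, hv, huv, hL⟩, ?_, hK⟩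
  exact (NonemptyCompacts.isOpen_subsets_of_isOpen (hu.union hv)).inter
    ((NonemptyCompacts.isOpen_inter_nonempty_of_isOpen hu).inter
      (NonemptyCompacts.isOpen_inter_nonempty_of_isOpen hv))

theorem mem_separated_of_finite {K : NonemptyCompacts X} (hfin : (K : Set X).Finite)
    (hK : K ∉ Set.range ({·} : X → NonemptyCompacts X)) : K ∈ separated X := by
  obtain ⟨a, ha⟩ := K.nonempty
  have hb : ((K : Set X) \ {a}).Nonempty := by
    by_contra h
    rw [Set.not_nonempty_iff_eq_empty, Set.sdiff_eq_empty] at h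
    refine hK ⟨a, SetLike.coe_injective ?_⟩
    exact Set.Subset.antisymm (Set.singleton_subset_iff.2 ha) h
  obtain ⟨b, hbK, hba⟩ := hb
  obtain ⟨u, v, hu, hv, hau, hKv, huv⟩ := SeparatedNhds.of_isCompact_isCompact
    (isCompact_singleton (x := a)) (hfin.sdiff (t := {a})).isCompact Set.disjoint_sdiff_right
  refine ⟨u, v, hu, hv, huv, fun x hx => ?_, ⟨a, ha, hau rfl⟩, ⟨b, hbK, hKv ⟨hbK, hba⟩⟩⟩
  by_cases hxa : x = a
  · exact Or.inl (hau hxa)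
  · exact Or.inr (hKv ⟨hx, hxa⟩)

theorem compl_range_singleton_subset_closure_separated :
    (Set.range ({·} : X → NonemptyCompacts X))ᶜ ⊆ closure (separated X) :=
  (NonemptyCompacts.dense_setOfPred_finite.open_subset_closure_inter
    NonemptyCompacts.isClosedEmbedding_singleton.isClosed_range.isOpen_compl).trans
    (closure_mono fun _ hK => mem_separated_of_finite hK.2 hK.1)

theorem eventually_residual_mem_separated_or_singleton :
    ∀ᶠ K in residual (NonemptyCompacts X), K ∈ separated X ∨ ∃ a : X, {a} = K := by
  have hopen : IsOpen (separated X ∪ (closure (separated X))ᶜ) :=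
    isOpen_separated.union isClosed_closure.isOpen_compl
  have hdense : Dense (separated X ∪ (closure (separated X))ᶜ) := by
    intro K
    by_cases hK : K ∈ closure (separated X)
    · exact closure_mono Set.subset_union_left hK
    · exact subset_closure (Or.inr hK)
  filter_upwards [residual_of_dense_open hopen hdense] with K hK
  refine hK.imp_right fun h => ?_
  by_contra hne
  exact h (compl_range_singleton_subset_closure_separated hne)

end GIFSInfinity

theorem mainTheorem1 {X : Type*} [MetricSpace X] [CompleteSpace X] [SeparableSpace X] :
    ∀ᶠ K in residual (NonemptyCompacts X),
      GIFSInfinity.IsGeneralizedFractal K ∧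
        ∀ r : ℝ≥0, 0 < r → r < 1 →
          ∃ (n : ℕ) (f : Fin n → GIFSInfinity.EllInfty K → X),
            GIFSInfinity.Witnesses K f ∧ ∀ i, LipschitzWith r (f i) := by
  filter_upwards [GIFSInfinity.eventually_residual_mem_separated_or_singleton] with K hK
  have key : ∀ r : ℝ≥0, 0 < r → r < 1 →
      ∃ (n : ℕ) (f : Fin n → GIFSInfinity.EllInfty K → X),
        GIFSInfinity.Witnesses K f ∧ ∀ i, LipschitzWith r (f i) := by
    intro r hr₀ hr₁
    rcases hK with hK | ⟨a, rfl⟩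
    · exact GIFSInfinity.exists_witnesses_of_mem_separated hK hr₀ hr₁
    · exact GIFSInfinity.exists_witnesses_singleton a hr₁
  obtain ⟨n, f, hf, -⟩ := key (1 / 2) (by norm_num) (NNReal.half_lt_self one_ne_zero)
  exact ⟨⟨n, f, hf⟩, key⟩
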